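/- Use indices starting at $0$. There is a polylogarithmic bound, uniform in the order $m\ge 0$ and in the dimensions $I_1,\dots,I_m\ge 1$, as follows. For a tensor $\mathcal A=(a_{i_1\cdots i_m})$ of size $I_1\times\cdots\times I_m$ with real or complex entries, let $\|\mathcal A\|_F=(\sum|a_{i_1\cdots i_m}|^2)^{1/2}$ and, for fixed $i_{k+1},\dots,i_m$, let $\mathcal A(:,\dots,:,i_{k+1},\dots,i_m)$ be the subtensor with the first $k$ indices free. Write each $i_k$ in binary with $n_k=\lceil\log_2 I_k\rceil$ digits, most significant digit first. The data structure of $\mathcal A$ is a perfect binary tree in which the digits of $i_m$, then those of $i_{m-1}$, …, then those of $i_1$ describe a path from the root (bit $0$ is left, bit $1$ is right). For a real tensor the tree has depth $n_1+\cdots+n_m$, and the leaf reached by $(i_1,\dots,i_m)$ stores $a_{i_1\cdots i_m}^2$ and $\operatorname{sgn}(a_{i_1\cdots i_m})$. For a complex tensor there is one more layer: the two children of the node reached by $(i_1,\dots,i_m)$ are leaves that store $(\operatorname{Re}a_{i_1\cdots i_m})^2$, $\operatorname{sgn}(\operatorname{Re}a_{i_1\cdots i_m})$ and $(\operatorname{Im}a_{i_1\cdots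 i_m})^2$, $\operatorname{sgn}(\operatorname{Im}a_{i_1\cdots i_m})$. All other leaves store $0$, and every interior node stores the sum of the weights of its children. Machine model: a quantum circuit has qubits and word registers that hold real numbers exactly, and access to the tree. Its elementary operations are: flipping a qubit; a memory query, which adds the weight or the sign stored at the node whose path is held (in superposition) by a list of qubits to a word register, or its inverse, in time $1+{}$the length of that list; an arithmetic operation ($+,-,\cdot,/,\sqrt{\ },\operatorname{atan2}$) on words whose result is added to a third word, or its inverse, in time $1$; the rotation $|0\rangle\mapsto\cos\theta|0\rangle+\sin\theta|1\rangle$, $|1\rangle\mapsto-\sin\theta|0\rangle+\cos\theta|1\rangle$ of a qubit, or the phase rotation $|1\rangle\mapsto e^{\mathrm i\theta}|1\rangle$ of a qubit, controlled by a word that holds the angle $\theta$, in time $1$. Theorem. (a) For every real or complex tensor $\mathcal A$ and every $0\le k\le m$, the node of the tree at the end of the path of $i_m,\dots,i_{k+1}$ stores $\|\mathcal A(:,\dots,:,i_{k+1},\dots,i_m)\|_F^2$; in particular the root stores $\|\mathcal A\|_F^2$. The leaves store the squares and the signs of the entries (of their real and imaginary parts, for complex tensors), and each interior node stores the sum of the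 weights of its children. (b) There are constants $C,d,a,r$ such that for all $m$ and all $I_1,\dots,I_m\ge1$ there is, for real tensors and likewise for complex tensors, a circuit that depends only on $(I_1,\dots,I_m)$, uses $n_1+\cdots+n_m$ data qubits, $a$ auxiliary qubits and $r$ word registers, runs in time at most $C\,(1+\log(I_1\cdots I_m))^d$, that is, $O(\mathrm{polylog}(I_1\cdots I_m))$, and, for every tensor $\mathcal A\ne0$ of this size, given access to the tree of $\mathcal A$, maps the initial state (all qubits $|0\rangle$, all words $0$) exactly to $$\frac1{\|\mathcal A\|_F}\sum_{i_1,\dots,i_m}a_{i_1\cdots i_m}\,|i_1\cdots i_m\rangle,$$ with all auxiliary qubits back in $|0\rangle$ and all words back at $0$. -/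

import Mathlib

namespace QuantumTensor

/-! ### Tensors and their Frobenius norms -/

/-- Tensors of shape `I 0 × I 1 × ⋯ × I (m-1)` with entries in `R` (all indices start at `0`). -/
abbrev Tensor (R : Type) {m : ℕ} (I : Fin m → ℕ) : Type := (∀ k, Fin (I k)) → R

/-- The Frobenius norm of a tensor. -/
noncomputable def frobNorm {R : Type} [Norm R] {m : ℕ} {I : Fin m → ℕ} (A : Tensor R I) : ℝ :=
  Real.sqrt (∑ i, ‖A i‖ ^ 2)

/-- The Frobenius norm of the subtensor of `A` in which the modes `l ≥ k` are fixed to the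
indices `i l`, while the modes `l < k` are free. -/
noncomputable def subNorm {R : Type} [Norm R] {m : ℕ} {I : Fin m → ℕ} (A : Tensor R I)
    (k : ℕ) (i : ∀ l, Fin (I l)) : ℝ :=
  Real.sqrt (∑ j with (∀ l : Fin m, k ≤ l.val → j l = i l), ‖A j‖ ^ 2)

/-! ### Binary encoding of multi-indices -/

/-- The qubits of the data registers: the register of mode `k` has `⌈log₂ (I k)⌉` qubits. -/
abbrev DataQubit {m : ℕ} (I : Fin m → ℕ) : Type := Σ k : Fin m, Fin (Nat.clog 2 (I k))

/-- The bit of the multi-index `i` at the qubit `⟨k, j⟩`: the `j`-th binary digit of `i k`,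
most significant digit first. -/
def indexBit {m : ℕ} {I : Fin m → ℕ} (i : ∀ k, Fin (I k)) (s : DataQubit I) : Bool :=
  (i s.1).val.testBit (Nat.clog 2 (I s.1) - 1 - s.2.val)

/-- The path given by the indices of the modes `l ≥ k`: the digits of the last mode come first,
those of mode `k` last. -/
def partialPath {m : ℕ} {I : Fin m → ℕ} (k : ℕ) (i : ∀ l, Fin (I l)) : List Bool :=
  ((List.finRange m).reverse.filter (fun l => k ≤ l.val)).flatMap
    (fun l => List.ofFn (fun j => indexBit i ⟨l, j⟩))

/-- The path of a full multi-index. -/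
def path {m : ℕ} {I : Fin m → ℕ} (i : ∀ l, Fin (I l)) : List Bool := partialPath 0 i

/-! ### The classical data structure -/

/-- Binary trees with a weight in every node, and also a sign in every leaf. -/
inductive NormTree : Type
  | leaf (weight : ℝ) (sign : SignType) : NormTree
  | node (weight : ℝ) (left right : NormTree) : NormTree

namespace NormTree

/-- The weight stored in the root. -/
def weight : NormTree → ℝ
  | leaf w _ => w
  | node w _ _ => w

/-- The sign stored in the root, if the tree is a single leaf; otherwise `0`. -/
def sign : NormTree → ℝ
  | leaf _ s => (s : ℝ)
  | node _ _ _ => 0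

/-- The subtree reached from the root along a path (`false` is left, `true` is right). -/
def subtree : NormTree → List Bool → Option NormTree
  | t, [] => some t
  | leaf _ _, _ :: _ => none
  | node _ l r, b :: p => if b then r.subtree p else l.subtree p

/-- The perfect binary tree of depth `n` that stores the real numbers `f p`, for `p` a bit string
of length `n`: the leaf at the end of the path `p` holds `(f p) ^ 2` and the sign of `f p`, and the
weight of an interior node is the sum of the weights of its two children. -/
noncomputable def build : ℕ → (List Bool → ℝ) → NormTree
  | 0, f => leaf ((f []) ^ 2) (SignType.sign (f []))
  | n + 1, f =>
    let l := build n (fun p => f (false :: p))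
    let r := build n (fun p => f (true :: p))
    node (l.weight + r.weight) l r

end NormTree

/-- The data structure of a real tensor. Bit strings that encode no multi-index carry the
number `0`. -/
noncomputable def realTree {m : ℕ} {I : Fin m → ℕ} (A : Tensor ℝ I) : NormTree :=
  NormTree.build (∑ k, Nat.clog 2 (I k)) (fun p => ∑ i, if p = path i then A i else 0)

/-- The data structure of a complex tensor: below the node of every entry there is one more layer,
whose left leaf stores the real part and whose right leaf stores the imaginary part. -/
noncomputable def complexTree {m : ℕ} {I : Fin m → ℕ} (A : Tensor ℂ I) : NormTree :=
  NormTree.build ((∑ k, Nat.clog 2 (I k)) + 1) (fun p =>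
    ∑ i, ((if p = path i ++ [false] then (A i).re else 0)
      + (if p = path i ++ [true] then (A i).im else 0)))

/-- `T` is a binary tree in which every interior node holds the sum of the weights of its children,
and in which the node at the end of the path `i_m, …, i_{k+1}` holds the squared Frobenius norm of
the subtensor `A(:, …, :, i_{k+1}, …, i_m)`, for `k = 0, …, m`; so the root holds the squared
Frobenius norm of `A`. -/
structure StoresNorms {R : Type} [Norm R] {m : ℕ} {I : Fin m → ℕ} (A : Tensor R I)
    (T : NormTree) : Prop where
  root : T.weight = frobNorm A ^ 2
  interior : ∀ (p : List Bool) (w : ℝ) (l r : NormTree),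
    T.subtree p = some (NormTree.node w l r) → w = l.weight + r.weight
  subtensor : ∀ k ≤ m, ∀ i : (∀ l, Fin (I l)),
    (T.subtree (partialPath k i)).map NormTree.weight = some (subNorm A k i ^ 2)

/-! ### Quantum circuits with access to the data structure

The machine has qubits, labelled by `Q`, and `r` word registers, each of which holds one real
number (stored numbers and arithmetic are exact). -/

/-- A basis state: the values of the qubits and the contents of the word registers. -/
abbrev Config (Q : Type) (r : ℕ) : Type := (Q → Bool) × (Fin r → ℝ)

/-- A (not necessarily normalized) state: a finite superposition of basis states. -/
abbrev QState (Q : Type) (r : ℕ) : Type := Config Q r →₀ ℂ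

/-- Arithmetic on words. -/
inductive Arith : Type
  | add | sub | mul | div | sqrt | atan2

/-- The value of an arithmetic operation; `sqrt` ignores its second argument, and `atan2 x y` is the
angle of the point `(x, y)` of the plane, in `(-π, π]`. -/
noncomputable def Arith.eval : Arith → ℝ → ℝ → ℝ
  | add, x, y => x + y
  | sub, x, y => x - y
  | mul, x, y => x * y
  | div, x, y => x / y
  | sqrt, x, _ => Real.sqrt x
  | atan2, x, y => Complex.arg ⟨x, y⟩

/-- The two fields of a memory cell. -/
inductive Field : Type
  | weight | sign

/-- The elementary operations. None of them refers to the stored data, except through `load` and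
`unload`. -/
inductive Gate (Q : Type) (r : ℕ) : Type
  /-- Flip a qubit. -/
  | not (t : Q)
  /-- Query the memory: add to the word `dst` the content of the cell whose address is the path that
  the qubits `addr` hold, in superposition. -/
  | load (addr : List Q) (f : Field) (dst : Fin r)
  /-- The inverse of `load`. -/
  | unload (addr : List Q) (f : Field) (dst : Fin r)
  /-- Add to the word `dst` the value of an operation on two other words. -/
  | arith (op : Arith) (a b dst : Fin r) (ha : a ≠ dst) (hb : b ≠ dst)
  /-- The inverse of `arith`. -/
  | unarith (op : Arith) (a b dst : Fin r) (ha : a ≠ dst) (hb : b ≠ dst)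
  /-- Rotate the qubit `t`, by the angle held in a word. -/
  | rot (t : Q) (angle : Fin r)
  /-- Rotate the phase of the component `|1⟩` of the qubit `t`, by the angle held in a word. -/
  | phase (t : Q) (angle : Fin r)

/-- The content of the memory cell with address `p`, and `0` if there is no such cell. -/
noncomputable def NormTree.cell (T : NormTree) (p : List Bool) : Field → ℝ
  | Field.weight => ((T.subtree p).map NormTree.weight).getD 0
  | Field.sign => ((T.subtree p).map NormTree.sign).getD 0

namespace Gate

variable {Q : Type} [DecidableEq Q] {r : ℕ}

/-- The action of an elementary operation on a basis state, if the memory holds `T`. -/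
noncomputable def onBasis (T : NormTree) : Gate Q r → Config Q r → QState Q r
  | not t, (b, x) => Finsupp.single (Function.update b t (!(b t)), x) 1
  | load addr f dst, (b, x) =>
      Finsupp.single (b, Function.update x dst (x dst + T.cell (addr.map b) f)) 1
  | unload addr f dst, (b, x) =>
      Finsupp.single (b, Function.update x dst (x dst - T.cell (addr.map b) f)) 1
  | arith op u v dst _ _, (b, x) =>
      Finsupp.single (b, Function.update x dst (x dst + op.eval (x u) (x v))) 1
  | unarith op u v dst _ _, (b, x) =>
      Finsupp.single (b, Function.update x dst (x dst - op.eval (x u) (x v))) 1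
  | rot t angle, (b, x) =>
      if b t then
        Finsupp.single (Function.update b t false, x) (-(Real.sin (x angle) : ℂ))
          + Finsupp.single (b, x) (Real.cos (x angle) : ℂ)
      else
        Finsupp.single (b, x) (Real.cos (x angle) : ℂ)
          + Finsupp.single (Function.update b t true, x) (Real.sin (x angle) : ℂ)
  | phase t angle, (b, x) =>
      Finsupp.single (b, x) (if b t then Complex.exp (Complex.I * (x angle : ℂ)) else 1)

/-- The linear action of an elementary operation on states. -/
noncomputable def apply (T : NormTree) (g : Gate Q r) : QState Q r →ₗ[ℂ] QState Q r :=
  Finsupp.linearCombination ℂ (g.onBasis T)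

/-- The time of an elementary operation: a query takes time proportional to the number of its
address qubits, everything else takes one unit. -/
def time : Gate Q r → ℕ
  | load addr _ _ => addr.length + 1
  | unload addr _ _ => addr.length + 1
  | _ => 1

end Gate

/-- A circuit: a sequence of elementary operations, applied from left to right. -/
abbrev Circuit (Q : Type) (r : ℕ) : Type := List (Gate Q r)

/-- The state that a circuit with access to `T` produces from `ψ`. -/
noncomputable def Circuit.run {Q : Type} [DecidableEq Q] {r : ℕ} (T : NormTree) (P : Circuit Q r)
    (ψ : QState Q r) : QState Q r :=
  P.foldl (fun φ g => g.apply T φ) ψ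

/-- The running time of a circuit. -/
def Circuit.time {Q : Type} {r : ℕ} (P : Circuit Q r) : ℕ := (P.map Gate.time).sum

/-- The initial state: all qubits are `|0⟩` and all words hold `0`. -/
noncomputable def zeroState (Q : Type) (r : ℕ) : QState Q r :=
  Finsupp.single (fun _ => false, fun _ => 0) 1

/-- The basis state `|i_1 ⋯ i_m⟩` of the data qubits, with `a` auxiliary qubits in the state `|0⟩`
and `r` word registers that hold `0`. -/
noncomputable def indexKet {m : ℕ} {I : Fin m → ℕ} (a r : ℕ) (i : ∀ k, Fin (I k)) :
    QState (DataQubit I ⊕ Fin a) r :=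
  Finsupp.single (Sum.elim (indexBit i) (fun _ => false), fun _ => 0) 1

end QuantumTensor

open QuantumTensor

namespace QuantumTensor

/-! ### Weights and leaves of the perfect trees `build n f`. -/

namespace NormTree

/-! The weight of a node is the total squared mass of the leaves below it
(`cell_weight_build_eq_sum`). Distinct multi-indices have distinct paths, and the path of `i_m, …,
i_{k+1}` is a prefix of a full path exactly when these indices agree (`partialPath_prefix_iff`);
this gives the norms of the subtensors.

The circuit descends the tree, one data qubit per level, in the order of the path. Invariant: each
node on the current level, written in the qubits treated so far, carries the square root of its
weight as amplitude. If the children have weights `s` and `t`, rotating the next qubit by θ = arg(√s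
+ i√t) turns √(s+t) into √s and √t, also when both vanish. The angle is computed into words, used
and uncomputed; the rotated qubit is not part of the address, so the uncomputation succeeds on both
branches (`run_splitCircuit`, `run_splitAll`). At the entries the amplitude is |a|, and one phase
exp(i arg a), read off from the leaves, completes it. `run_splitAll_append` combines the two stages
for both kinds of tensor.

With n digits in all there are n splits of cost O(n), and n is at most 3 log ∏ I_k
(`time_le_polylog`). -/

lemma subtree_build (n : ℕ) (f : List Bool → ℝ) (p : List Bool) (hp : p.length ≤ n) :
    (build n f).subtree p = some (build (n - p.length) (fun q => f (p ++ q))) := by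
  induction p generalizing n f with
  | nil => cases n <;> simp [subtree]
  | cons b p ih =>
    obtain _ | n := n
    · simp at hp
    · have hp' : p.length ≤ n := by simpa using hp
      cases b <;> simp [build, subtree, ih n _ hp']

lemma interior_build (n : ℕ) (f : List Bool → ℝ) (p : List Bool) (w : ℝ) (l r : NormTree)
    (h : (build n f).subtree p = some (node w l r)) : w = l.weight + r.weight := by
  induction n generalizing f p with
  | zero => cases p <;> simp [build, subtree] at h
  | succ n ih =>
    cases p with
    | nil =>
      simp only [build, subtree, Option.some.injEq, node.injEq] at h
      obtain ⟨rfl, rfl, rfl⟩ := h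
      rfl
    | cons b p =>
      cases b
      · exact ih _ p (by simpa [build, subtree] using h)
      · exact ih _ p (by simpa [build, subtree] using h)

lemma weight_build (n : ℕ) (f : List Bool → ℝ) :
    (build n f).weight = ∑ b : Fin n → Bool, f (List.ofFn b) ^ 2 := by
  induction n generalizing f with
  | zero => simp [build, weight]
  | succ n ih =>
    rw [← (Fin.consEquiv (fun _ : Fin (n + 1) => Bool)).sum_comp, Fintype.sum_prod_type]
    have h : (build (n + 1) f).weight = (build n fun p => f (false :: p)).weight
        + (build n fun p => f (true :: p)).weight := rfl
    simp [h, ih, Fin.consEquiv, List.ofFn_succ, add_comm]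

lemma weight_build_nonneg (n : ℕ) (f : List Bool → ℝ) : 0 ≤ (build n f).weight := by
  rw [weight_build]
  positivity

/-- If the squares of the stored numbers are the point masses `c j` at the paths `P j`, the weight
at the root is the total mass. -/
lemma weight_build_eq_sum {ι : Type} (S : Finset ι) (P : ι → List Bool) (c : ι → ℝ) (n : ℕ)
    (f : List Bool → ℝ) (hP : ∀ j ∈ S, (P j).length = n)
    (hf : ∀ p, p.length = n → f p ^ 2 = ∑ j ∈ S, if P j = p then c j else 0) :
    (build n f).weight = ∑ j ∈ S, c j := by
  rw [weight_build, Finset.sum_congr rfl fun b _ => hf _ (by simp), Finset.sum_comm]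
  refine Finset.sum_congr rfl fun j hj => ?_
  obtain ⟨b, hb⟩ : ∃ b : Fin n → Bool, List.ofFn b = P j := by
    have := hP j hj
    subst this
    exact ⟨(P j).get, List.ofFn_get _⟩
  simp [← hb, List.ofFn_injective.eq_iff]

lemma cell_weight_build (n : ℕ) (f : List Bool → ℝ) (p : List Bool) (hp : p.length ≤ n) :
    (build n f).cell p Field.weight = (build (n - p.length) (fun q => f (p ++ q))).weight := by
  simp [cell, subtree_build n f p hp]

/-- The subtree at `p` is again a `build`; it holds the masses whose path extends `p`, at the
remaining suffixes. A general index type `ι` lets real and imaginary parts count as separate masses.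
-/
lemma cell_weight_build_eq_sum {ι : Type} (S : Finset ι) (P : ι → List Bool) (c : ι → ℝ) (n : ℕ)
    (f : List Bool → ℝ) (hP : ∀ j ∈ S, (P j).length = n)
    (hf : ∀ p, p.length = n → f p ^ 2 = ∑ j ∈ S, if P j = p then c j else 0) (p : List Bool)
    (hp : p.length ≤ n) :
    (build n f).cell p Field.weight = ∑ j ∈ S with p <+: P j, c j := by
  rw [cell_weight_build n f p hp]
  apply weight_build_eq_sum _ (fun j => (P j).drop p.length)
  · intro j hj
    simp [hP j (Finset.mem_filter.1 hj).1]
  · intro q hq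
    rw [hf _ (by simp; omega), Finset.sum_filter]
    refine Finset.sum_congr rfl fun j _ => ?_
    by_cases h : p <+: P j
    · obtain ⟨t, ht⟩ := h
      simp [← ht]
    · have : P j ≠ p ++ q := fun h' => h ⟨q, h'.symm⟩
      simp [h, this]

lemma cell_weight_build_nonneg (n : ℕ) (f : List Bool → ℝ) (p : List Bool) (hp : p.length ≤ n) :
    0 ≤ (build n f).cell p Field.weight := by
  rw [cell_weight_build n f p hp]
  exact weight_build_nonneg _ _

lemma cell_weight_build_add (n : ℕ) (f : List Bool → ℝ) (p : List Bool) (hp : p.length < n) :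
    (build n f).cell p Field.weight
      = (build n f).cell (p ++ [false]) Field.weight
        + (build n f).cell (p ++ [true]) Field.weight := by
  rw [cell_weight_build n f p hp.le, cell_weight_build n f _ (by simpa using hp),
    cell_weight_build n f _ (by simpa using hp)]
  obtain ⟨k, rfl⟩ : ∃ k, n = p.length + (k + 1) := ⟨n - p.length - 1, by omega⟩
  have h : p.length + (k + 1) - (p.length + 1) = k := by omega
  simp [build, weight, h]

lemma cell_weight_build_leaf (n : ℕ) (f : List Bool → ℝ) (p : List Bool) (hp : p.length = n) :
    (build n f).cell p Field.weight = f p ^ 2 := by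
  simp [cell_weight_build n f p hp.le, hp, build, weight]

lemma subtree_build_leaf (n : ℕ) (f : List Bool → ℝ) (p : List Bool) (hp : p.length = n) :
    (build n f).subtree p = some (leaf (f p ^ 2) (SignType.sign (f p))) := by
  simp [subtree_build n f p hp.le, hp, build]

lemma cell_sign_build_leaf (n : ℕ) (f : List Bool → ℝ) (p : List Bool) (hp : p.length = n) :
    (build n f).cell p Field.sign = (SignType.sign (f p) : ℝ) := by
  simp [cell, subtree_build_leaf n f p hp, sign]

end NormTree

/-! ### Paths -/

section Paths

variable {m : ℕ} {I : Fin m → ℕ}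

/-- The qubits of the modes `l ≥ k`, in the order of the path. -/
def qubitList (I : Fin m → ℕ) (k : ℕ) : List (DataQubit I) :=
  ((List.finRange m).reverse.filter (fun l => k ≤ l.val)).flatMap
    (fun l => List.ofFn (fun j => ⟨l, j⟩))

lemma partialPath_eq_map (k : ℕ) (i : ∀ l, Fin (I l)) :
    partialPath k i = (qubitList I k).map (indexBit i) := by
  simp [partialPath, qubitList, List.map_flatMap, List.map_ofFn, Function.comp_def]

lemma mem_qubitList (k : ℕ) (s : DataQubit I) : s ∈ qubitList I k ↔ k ≤ s.1.val := by
  obtain ⟨l, j⟩ := s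
  simp only [qubitList, List.mem_flatMap, List.mem_filter, List.mem_reverse, List.mem_finRange,
    true_and, decide_eq_true_eq, List.mem_ofFn]
  constructor
  · rintro ⟨l', hl', j', h⟩
    cases h
    exact hl'
  · exact fun h => ⟨l, h, j, rfl⟩

lemma nodup_qubitList (k : ℕ) : (qubitList I k).Nodup := by
  rw [qubitList, List.nodup_flatMap]
  refine ⟨fun l _ => List.nodup_ofFn.2 fun a b h => by simpa using h, ?_⟩
  have h : ((List.finRange m).reverse.filter (fun l => decide (k ≤ l.val))).Nodup :=
    (List.nodup_reverse.2 (List.nodup_finRange m)).filter _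
  refine List.Pairwise.imp ?_ h
  intro a b hab
  simp only [Function.onFun, List.disjoint_left, List.mem_ofFn]
  rintro _ ⟨j, rfl⟩ ⟨j', h⟩
  cases h
  exact hab rfl

lemma length_qubitList : (qubitList I 0).length = ∑ k, Nat.clog 2 (I k) := by
  simp [qubitList, List.length_flatMap, Fin.sum_univ_def]

/-- By the pairwise hypothesis, once `p` fails it fails on the rest of the list, so filtering only
cuts off a tail. -/
lemma filter_prefix_of_pairwise {α : Type} (p : α → Bool) (l : List α)
    (h : l.Pairwise fun a b => p b → p a) : l.filter p <+: l := by
  induction l with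
  | nil => simp
  | cons a l ih =>
    rw [List.pairwise_cons] at h
    cases ha : p a
    · have : l.filter p = [] := List.filter_eq_nil_iff.2 fun b hb hpb => by simp [h.1 b hb hpb] at ha
      simp [ha, this]
    · simpa [ha] using ih h.2

lemma qubitList_prefix (k : ℕ) : qubitList I k <+: qubitList I 0 := by
  have h : (List.finRange m).reverse.filter (fun l => decide (k ≤ l.val))
      <+: (List.finRange m).reverse := by
    apply filter_prefix_of_pairwise
    rw [List.pairwise_reverse]
    refine List.Pairwise.imp ?_ (List.pairwise_lt_finRange m)
    intro a b hab
    simp only [decide_eq_true_eq]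
    have := Fin.lt_def.1 hab
    omega
  obtain ⟨t, ht⟩ := h
  refine ⟨t.flatMap (fun l => List.ofFn (fun j => ⟨l, j⟩)), ?_⟩
  simp only [qubitList, zero_le, decide_true, List.filter_true, ← List.flatMap_append, ht]

lemma length_path (i : ∀ l, Fin (I l)) : (path i).length = ∑ k, Nat.clog 2 (I k) := by
  simp [path, partialPath_eq_map, length_qubitList]

lemma eq_of_indexBit_eq (i j : ∀ l, Fin (I l)) (l : Fin m)
    (h : ∀ a, indexBit i ⟨l, a⟩ = indexBit j ⟨l, a⟩) : i l = j l := by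
  apply Fin.ext
  apply Nat.eq_of_testBit_eq
  intro t
  by_cases ht : t < Nat.clog 2 (I l)
  · have := h ⟨Nat.clog 2 (I l) - 1 - t, by omega⟩
    simp only [indexBit] at this
    rwa [show Nat.clog 2 (I l) - 1 - (Nat.clog 2 (I l) - 1 - t) = t by omega] at this
  -- Digits beyond the register vanish on both sides, since the indices are below `I l`.
  · have hI : I l ≤ 2 ^ t :=
      (Nat.le_pow_clog one_lt_two _).trans (Nat.pow_le_pow_right two_pos (not_lt.1 ht))
    rw [Nat.testBit_lt_two_pow ((i l).2.trans_le hI), Nat.testBit_lt_two_pow ((j l).2.trans_le hI)]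

lemma partialPath_eq_iff (k : ℕ) (i j : ∀ l, Fin (I l)) :
    partialPath k i = partialPath k j ↔ ∀ l : Fin m, k ≤ l.val → j l = i l := by
  rw [partialPath_eq_map, partialPath_eq_map, List.map_inj_left]
  simp only [mem_qubitList]
  constructor
  · exact fun h l hl => (eq_of_indexBit_eq i j l fun a => h ⟨l, a⟩ hl).symm
  · intro h s hs
    simp [indexBit, h s.1 hs]

/-- Both partial paths have the same length, so if both are prefixes of `path j` they coincide. -/
lemma partialPath_prefix_iff (k : ℕ) (i j : ∀ l, Fin (I l)) :
    partialPath k i <+: path j ↔ ∀ l : Fin m, k ≤ l.val → j l = i l := by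
  rw [← partialPath_eq_iff]
  have h : partialPath k j <+: path j := by
    rw [path, partialPath_eq_map, partialPath_eq_map]
    exact (qubitList_prefix k).map _
  constructor
  · intro h'
    have hl : (partialPath k i).length = (partialPath k j).length := by simp [partialPath_eq_map]
    exact (List.prefix_of_prefix_length_le h' h hl.le).eq_of_length hl
  · rintro h'
    rwa [h']

lemma path_inj (i j : ∀ l, Fin (I l)) : path i = path j ↔ i = j := by
  rw [path, path, partialPath_eq_iff]
  simp [funext_iff, eq_comm]

lemma map_qubitList_eq_path_iff (b : DataQubit I → Bool) (i : ∀ l, Fin (I l)) :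
    (qubitList I 0).map b = path i ↔ b = indexBit i := by
  rw [path, partialPath_eq_map, List.map_inj_left]
  simp [mem_qubitList, funext_iff]

lemma length_partialPath_le (k : ℕ) (i : ∀ l, Fin (I l)) :
    (partialPath k i).length ≤ ∑ k, Nat.clog 2 (I k) := by
  simpa [partialPath_eq_map, ← length_qubitList] using (qubitList_prefix k).length_le

end Paths

/-! ### The data structure stores the norms -/

section Stores

variable {m : ℕ} {I : Fin m → ℕ}

lemma frobNorm_sq {R : Type} [Norm R] (A : Tensor R I) :
    frobNorm A ^ 2 = ∑ i, ‖A i‖ ^ 2 :=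
  Real.sq_sqrt (Finset.sum_nonneg fun _ _ => sq_nonneg _)

lemma subNorm_sq {R : Type} [Norm R] (A : Tensor R I) (k : ℕ) (i : ∀ l, Fin (I l)) :
    subNorm A k i ^ 2 = ∑ j with (∀ l : Fin m, k ≤ l.val → j l = i l), ‖A j‖ ^ 2 :=
  Real.sq_sqrt (Finset.sum_nonneg fun _ _ => sq_nonneg _)

/-- Common to both trees: the complex one is a layer deeper, but only nodes down to the level of the
entries matter here. -/
lemma storesNorms_build {R : Type} [Norm R] (A : Tensor R I) (N : ℕ) (f : List Bool → ℝ)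
    (hN : ∑ k, Nat.clog 2 (I k) ≤ N)
    (h : ∀ p : List Bool, p.length ≤ ∑ k, Nat.clog 2 (I k) →
      (NormTree.build N f).cell p Field.weight = ∑ i with p <+: path i, ‖A i‖ ^ 2) :
    StoresNorms A (NormTree.build N f) where
  root := by
    have := h [] (by simp)
    simpa [frobNorm_sq, NormTree.cell, NormTree.subtree] using this
  interior := NormTree.interior_build N f
  subtensor k _ i := by
    have hl := length_partialPath_le k i
    have h1 := h _ hl
    simp only [partialPath_prefix_iff] at h1
    rw [subNorm_sq, ← h1, NormTree.cell, NormTree.subtree_build _ _ _ (hl.trans hN)]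
    simp

lemma sum_ite_path {M : Type} [AddCommMonoid M] (a : (∀ l, Fin (I l)) → M)
    (i : ∀ l, Fin (I l)) : (∑ j, if path i = path j then a j else 0) = a i := by
  simp [path_inj]

/-- Paths are distinct, so at most one term survives and no cross terms arise. -/
lemma sq_sum_ite_path (a : (∀ l, Fin (I l)) → ℝ) (p : List Bool) :
    (∑ i, if p = path i then a i else 0) ^ 2 = ∑ i, if path i = p then a i ^ 2 else 0 := by
  by_cases h : ∃ i : ∀ l, Fin (I l), path i = p
  · obtain ⟨i, rfl⟩ := h
    simp [path_inj]
  · simp only [not_exists] at h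
    have h' : ∀ i, p ≠ path i := fun i => Ne.symm (h i)
    simp [h, h']

lemma cell_realTree (A : Tensor ℝ I) (p : List Bool) (hp : p.length ≤ ∑ k, Nat.clog 2 (I k)) :
    (realTree A).cell p Field.weight = ∑ i with p <+: path i, ‖A i‖ ^ 2 := by
  simp only [Real.norm_eq_abs, sq_abs]
  exact NormTree.cell_weight_build_eq_sum _ path _ _ _ (fun j _ => length_path j)
    (fun p _ => sq_sum_ite_path A p) p hp

lemma storesNorms_realTree (A : Tensor ℝ I) : StoresNorms A (realTree A) :=
  storesNorms_build A _ _ le_rfl (cell_realTree A)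

lemma subtree_realTree (A : Tensor ℝ I) (i : ∀ l, Fin (I l)) :
    (realTree A).subtree (path i) = some (NormTree.leaf ((A i) ^ 2) (SignType.sign (A i))) := by
  rw [realTree, NormTree.subtree_build_leaf _ _ _ (length_path i), sum_ite_path]

/-- The number stored by `complexTree A` at a leaf. -/
noncomputable def complexLeaf (A : Tensor ℂ I) (p : List Bool) : ℝ :=
  ∑ i, ((if p = path i ++ [false] then (A i).re else 0)
      + (if p = path i ++ [true] then (A i).im else 0))

lemma complexLeaf_false (A : Tensor ℂ I) (p : List Bool) :
    complexLeaf A (p ++ [false]) = (∑ i, if p = path i then A i else 0).re := by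
  simp [complexLeaf, apply_ite Complex.re]

lemma complexLeaf_true (A : Tensor ℂ I) (p : List Bool) :
    complexLeaf A (p ++ [true]) = (∑ i, if p = path i then A i else 0).im := by
  simp [complexLeaf, apply_ite Complex.im]

lemma cell_complexTree (A : Tensor ℂ I) (p : List Bool) (hp : p.length ≤ ∑ k, Nat.clog 2 (I k)) :
    (complexTree A).cell p Field.weight = ∑ i with p <+: path i, ‖A i‖ ^ 2 := by
  have key := NormTree.cell_weight_build_eq_sum (Finset.univ : Finset ((∀ l, Fin (I l)) × Bool))
    (fun j => path j.1 ++ [j.2]) (fun j => if j.2 then (A j.1).im ^ 2 else (A j.1).re ^ 2)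
    ((∑ k, Nat.clog 2 (I k)) + 1) (complexLeaf A) (fun j _ => by simp [length_path]) ?_ p
    (by omega)
  · refine key.trans ?_
    rw [Finset.sum_filter, Finset.sum_filter, Fintype.sum_prod_type]
    refine Finset.sum_congr rfl fun i _ => ?_
    -- `p` is too short to reach the last bit, so both parts of an entry lie below `p` or neither
    -- does.
    have h : ∀ b, p <+: path i ++ [b] ↔ p <+: path i := fun b =>
      ⟨fun h => List.prefix_of_prefix_length_le h (List.prefix_append _ _)
        (by rwa [length_path]), fun h => h.trans (List.prefix_append _ _)⟩
    simp only [h, Fintype.sum_bool]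
    by_cases h' : p <+: path i
    · simp only [h', if_true, Complex.sq_norm, Complex.normSq_apply, Bool.false_eq_true, if_false]
      ring
    · simp [h']
  · intro q hq
    obtain ⟨p, b, rfl⟩ : ∃ p b, q = p ++ [b] :=
      ⟨q.dropLast, q.getLast (fun h => by simp [h] at hq), (List.dropLast_append_getLast _).symm⟩
    rw [Fintype.sum_prod_type]
    cases b
    · simpa [complexLeaf] using sq_sum_ite_path (fun i => (A i).re) p
    · simpa [complexLeaf] using sq_sum_ite_path (fun i => (A i).im) p

lemma storesNorms_complexTree (A : Tensor ℂ I) : StoresNorms A (complexTree A) :=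
  storesNorms_build A _ _ (Nat.le_succ _) (cell_complexTree A)

lemma subtree_complexTree_false (A : Tensor ℂ I) (i : ∀ l, Fin (I l)) :
    (complexTree A).subtree (path i ++ [false])
      = some (NormTree.leaf ((A i).re ^ 2) (SignType.sign (A i).re)) := by
  refine (NormTree.subtree_build_leaf _ (complexLeaf A) _ (by simp [length_path])).trans ?_
  rw [complexLeaf_false, sum_ite_path]

lemma subtree_complexTree_true (A : Tensor ℂ I) (i : ∀ l, Fin (I l)) :
    (complexTree A).subtree (path i ++ [true])
      = some (NormTree.leaf ((A i).im ^ 2) (SignType.sign (A i).im)) := by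
  refine (NormTree.subtree_build_leaf _ (complexLeaf A) _ (by simp [length_path])).trans ?_
  rw [complexLeaf_true, sum_ite_path]

end Stores

/-! ### Composition and linearity of circuits. -/

lemma Circuit.time_append {Q : Type} {r : ℕ} (P₁ P₂ : Circuit Q r) :
    Circuit.time (P₁ ++ P₂) = Circuit.time P₁ + Circuit.time P₂ := by
  simp [Circuit.time]

section Run

variable {Q : Type} [DecidableEq Q] {r : ℕ} (T : NormTree)

lemma Circuit.run_append (P₁ P₂ : Circuit Q r) (ψ : QState Q r) :
    Circuit.run T (P₁ ++ P₂) ψ = Circuit.run T P₂ (Circuit.run T P₁ ψ) := by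
  simp [Circuit.run]

lemma Circuit.run_cons (g : Gate Q r) (P : Circuit Q r) (ψ : QState Q r) :
    Circuit.run T (g :: P) ψ = Circuit.run T P (g.apply T ψ) := rfl

lemma Circuit.run_nil (ψ : QState Q r) : Circuit.run T ([] : Circuit Q r) ψ = ψ := rfl

lemma Circuit.run_add (P : Circuit Q r) (ψ φ : QState Q r) :
    P.run T (ψ + φ) = P.run T ψ + P.run T φ := by
  induction P generalizing ψ φ with
  | nil => rfl
  | cons g P ih => simp [Circuit.run_cons, ih]

lemma Circuit.run_smul (P : Circuit Q r) (z : ℂ) (ψ : QState Q r) :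
    P.run T (z • ψ) = z • P.run T ψ := by
  induction P generalizing ψ with
  | nil => rfl
  | cons g P ih => simp [Circuit.run_cons, ih]

lemma Gate.apply_single (g : Gate Q r) (c : Config Q r) :
    g.apply T (Finsupp.single c 1) = g.onBasis T c := by
  simp [Gate.apply]

end Run

/-! ### The splitting and phase circuits, their running times and their action. -/

section Circuits

variable {D : Type}

/-- The state `|b⟩` of the data qubits, with one auxiliary qubit in the state `v` and words `x`. -/
def dataConfig {r : ℕ} (b : D → Bool) (v : Bool) (x : Fin r → ℝ) : Config (D ⊕ Fin 1) r :=
  (Sum.elim b (fun _ => v), x)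

section Steps

variable [DecidableEq D] {r : ℕ} (T : NormTree) (b : D → Bool) (v : Bool) (x : Fin r → ℝ)

/-- The address that consists of data qubits, followed by the auxiliary qubit. -/
def childAddr (L : List D) : List (D ⊕ Fin 1) := L.map Sum.inl ++ [Sum.inr 0]

lemma apply_not_aux :
    (Gate.not (Sum.inr 0) : Gate (D ⊕ Fin 1) r).apply T (Finsupp.single (dataConfig b v x) 1)
      = Finsupp.single (dataConfig b (!v) x) 1 := by
  rw [Gate.apply_single]
  simp only [dataConfig, Gate.onBasis, Sum.elim_inr, Sum.update_elim_inr]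
  congr 3
  ext j
  simp [Subsingleton.elim j 0]

lemma apply_load_child (L : List D) (f : Field) (d : Fin r) :
    (Gate.load (childAddr L) f d).apply T (Finsupp.single (dataConfig b v x) 1)
      = Finsupp.single (dataConfig b v
          (Function.update x d (x d + T.cell (L.map b ++ [v]) f))) 1 := by
  rw [Gate.apply_single]
  simp [dataConfig, Gate.onBasis, childAddr, Function.comp_def]

lemma apply_unload_child (L : List D) (f : Field) (d : Fin r) :
    (Gate.unload (childAddr L) f d).apply T (Finsupp.single (dataConfig b v x) 1)
      = Finsupp.single (dataConfig b v
          (Function.update x d (x d - T.cell (L.map b ++ [v]) f))) 1 := by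
  rw [Gate.apply_single]
  simp [dataConfig, Gate.onBasis, childAddr, Function.comp_def]

lemma apply_load_data (L : List D) (f : Field) (d : Fin r) :
    (Gate.load (L.map Sum.inl : List (D ⊕ Fin 1)) f d).apply T
        (Finsupp.single (dataConfig b v x) 1)
      = Finsupp.single (dataConfig b v
          (Function.update x d (x d + T.cell (L.map b) f))) 1 := by
  rw [Gate.apply_single]
  simp [dataConfig, Gate.onBasis, Function.comp_def]

lemma apply_unload_data (L : List D) (f : Field) (d : Fin r) :
    (Gate.unload (L.map Sum.inl : List (D ⊕ Fin 1)) f d).apply T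
        (Finsupp.single (dataConfig b v x) 1)
      = Finsupp.single (dataConfig b v
          (Function.update x d (x d - T.cell (L.map b) f))) 1 := by
  rw [Gate.apply_single]
  simp [dataConfig, Gate.onBasis, Function.comp_def]

lemma apply_arith (op : Arith) (i j d : Fin r) (hi : i ≠ d) (hj : j ≠ d) :
    (Gate.arith op i j d hi hj : Gate (D ⊕ Fin 1) r).apply T
        (Finsupp.single (dataConfig b v x) 1)
      = Finsupp.single (dataConfig b v
          (Function.update x d (x d + op.eval (x i) (x j)))) 1 := by
  rw [Gate.apply_single]
  rfl

lemma apply_unarith (op : Arith) (i j d : Fin r) (hi : i ≠ d) (hj : j ≠ d) :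
    (Gate.unarith op i j d hi hj : Gate (D ⊕ Fin 1) r).apply T
        (Finsupp.single (dataConfig b v x) 1)
      = Finsupp.single (dataConfig b v
          (Function.update x d (x d - op.eval (x i) (x j)))) 1 := by
  rw [Gate.apply_single]
  rfl

/-- With the auxiliary qubit set, the phase gate multiplies the basis state by a scalar determined
by a word, whatever the data qubits are. -/
lemma apply_phase_aux (w : Fin r) :
    (Gate.phase (Sum.inr 0) w : Gate (D ⊕ Fin 1) r).apply T
        (Finsupp.single (dataConfig b true x) 1)
      = Complex.exp (Complex.I * (x w : ℂ)) • Finsupp.single (dataConfig b true x) 1 := by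
  rw [Gate.apply_single]
  simp [dataConfig, Gate.onBasis]

/-- Only the value `false` is needed: every data qubit is rotated once, while still zero. -/
lemma apply_rot_data (q : D) (hq : b q = false) (w : Fin r) :
    (Gate.rot (Sum.inl q) w : Gate (D ⊕ Fin 1) r).apply T
        (Finsupp.single (dataConfig b v x) 1)
      = (Real.cos (x w) : ℂ) • Finsupp.single (dataConfig b v x) 1
        + (Real.sin (x w) : ℂ) • Finsupp.single (dataConfig (Function.update b q true) v x) 1 := by
  rw [Gate.apply_single]
  simp only [dataConfig, Gate.onBasis, Sum.elim_inl, hq, Bool.false_eq_true, if_false,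
    Sum.update_elim_inl, Finsupp.smul_single, smul_eq_mul, mul_one]

end Steps

/-- Computes the angle of the rotation of the first qubit after `L` in the word `4`. -/
def computeAngle (L : List D) : Circuit (D ⊕ Fin 1) 9 :=
  [.load (childAddr L) .weight 0, .not (.inr 0), .load (childAddr L) .weight 1, .not (.inr 0),
    .arith .sqrt 0 0 2 (by decide) (by decide), .arith .sqrt 1 1 3 (by decide) (by decide),
    .arith .atan2 2 3 4 (by decide) (by decide)]

/-- The inverse of `computeAngle`. -/
def uncomputeAngle (L : List D) : Circuit (D ⊕ Fin 1) 9 :=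
  [.unarith .atan2 2 3 4 (by decide) (by decide), .unarith .sqrt 1 1 3 (by decide) (by decide),
    .unarith .sqrt 0 0 2 (by decide) (by decide), .not (.inr 0),
    .unload (childAddr L) .weight 1, .not (.inr 0), .unload (childAddr L) .weight 0]

/-- Splits the amplitude of the node at the end of the path `L` between its two children. -/
def splitCircuit (L : List D) (q : D) : Circuit (D ⊕ Fin 1) 9 :=
  computeAngle L ++ [.rot (.inl q) 4] ++ uncomputeAngle L

/-- Splits the amplitudes along the qubits of the second list, which follow those of the first. -/
def splitAll : List D → List D → Circuit (D ⊕ Fin 1) 9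
  | _, [] => []
  | L, q :: L' => splitCircuit L q ++ splitAll (L ++ [q]) L'

/-- Multiplies by the sign stored at the leaf with address `L`. -/
def signCircuit (L : List D) : Circuit (D ⊕ Fin 1) 9 :=
  [.load (L.map .inl) .sign 0, .arith .atan2 0 1 2 (by decide) (by decide), .not (.inr 0),
    .phase (.inr 0) 2,
    .not (.inr 0), .unarith .atan2 0 1 2 (by decide) (by decide), .unload (L.map .inl) .sign 0]

/-- Multiplies by the phase of the number whose real and imaginary part are stored below `L`. -/
def phaseCircuit (L : List D) : Circuit (D ⊕ Fin 1) 9 :=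
  [.load (childAddr L) .weight 0, .load (childAddr L) .sign 1,
    .arith .sqrt 0 0 2 (by decide) (by decide), .arith .mul 1 2 3 (by decide) (by decide),
    .not (.inr 0),
    .load (childAddr L) .weight 4, .load (childAddr L) .sign 5,
    .arith .sqrt 4 4 6 (by decide) (by decide), .arith .mul 5 6 7 (by decide) (by decide),
    .arith .atan2 3 7 8 (by decide) (by decide),
    .phase (.inr 0) 8,
    .unarith .atan2 3 7 8 (by decide) (by decide),
    .unarith .mul 5 6 7 (by decide) (by decide), .unarith .sqrt 4 4 6 (by decide) (by decide),
    .unload (childAddr L) .sign 5, .unload (childAddr L) .weight 4,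
    .not (.inr 0),
    .unarith .mul 1 2 3 (by decide) (by decide), .unarith .sqrt 0 0 2 (by decide) (by decide),
    .unload (childAddr L) .sign 1, .unload (childAddr L) .weight 0]

lemma length_childAddr (L : List D) : (childAddr L).length = L.length + 1 := by
  simp [childAddr]

lemma time_splitAll (L L' : List D) :
    (splitAll L L').time ≤ L'.length * (4 * (L.length + L'.length) + 19) := by
  induction L' generalizing L with
  | nil => simp [splitAll, Circuit.time]
  | cons q L' ih =>
    have h := ih (L ++ [q])
    rw [splitAll, Circuit.time_append]
    -- Four queries of time `L.length + 2` and eleven unit operations.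
    have h1 : (splitCircuit L q).time = 4 * L.length + 19 := by
      simp only [splitCircuit, computeAngle, uncomputeAngle, Circuit.time, Gate.time,
        length_childAddr, List.cons_append, List.nil_append, List.map_cons, List.map_nil,
        List.sum_cons, List.sum_nil]
      omega
    rw [h1]
    simp only [List.length_append, List.length_cons, List.length_nil] at h ⊢
    nlinarith

lemma time_signCircuit (L : List D) : (signCircuit L).time = 2 * L.length + 7 := by
  simp [signCircuit, Circuit.time, Gate.time]
  ring

lemma time_phaseCircuit (L : List D) : (phaseCircuit L).time = 8 * L.length + 29 := by
  simp only [phaseCircuit, Circuit.time, Gate.time, length_childAddr, List.map_cons, List.map_nil,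
    List.sum_cons, List.sum_nil]
  omega

/-- The basis state with data qubits `b`, in which everything else is zero. -/
noncomputable def dataKet (b : D → Bool) : QState (D ⊕ Fin 1) 9 :=
  Finsupp.single (dataConfig b false 0) 1

variable [DecidableEq D] (T : NormTree)

/-- The words in which `computeAngle` leaves its results, for children of weights `s` and `t`. -/
noncomputable def angleWords (s t : ℝ) : Fin 9 → ℝ :=
  ![s, t, √s, √t, Complex.arg ⟨√s, √t⟩, 0, 0, 0, 0]

lemma run_computeAngle (L : List D) (b : D → Bool) :
    (computeAngle L).run T (dataKet b)
      = Finsupp.single (dataConfig b false (angleWords (T.cell (L.map b ++ [false]) .weight)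
          (T.cell (L.map b ++ [true]) .weight))) 1 := by
  simp only [computeAngle, Circuit.run_cons, Circuit.run_nil, dataKet, apply_not_aux,
    apply_load_child, apply_arith, Bool.not_false, Bool.not_true]
  congr 2
  ext i
  fin_cases i <;> simp [angleWords, Arith.eval, Function.update]

lemma run_uncomputeAngle (L : List D) (b : D → Bool) :
    (uncomputeAngle L).run T (Finsupp.single (dataConfig b false
        (angleWords (T.cell (L.map b ++ [false]) .weight)
          (T.cell (L.map b ++ [true]) .weight))) 1) = dataKet b := by
  simp only [uncomputeAngle, Circuit.run_cons, Circuit.run_nil, dataKet, apply_not_aux,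
    apply_unload_child, apply_unarith, Bool.not_false, Bool.not_true]
  congr 2
  ext i
  fin_cases i <;> simp [angleWords, Arith.eval, Function.update]

/-- The point (√s, √t) has modulus √(s+t). The polar identity also holds at the origin, so nodes of
weight zero need no separate treatment. -/
lemma sqrt_mul_cos_arg (s t : ℝ) (hs : 0 ≤ s) (ht : 0 ≤ t) :
    √(s + t) * Real.cos (Complex.arg ⟨√s, √t⟩) = √s := by
  have h : ‖(⟨√s, √t⟩ : ℂ)‖ = √(s + t) := by
    rw [Complex.norm_def, Complex.normSq_mk, Real.mul_self_sqrt hs, Real.mul_self_sqrt ht]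
  rw [← h, Complex.norm_mul_cos_arg]

lemma sqrt_mul_sin_arg (s t : ℝ) (hs : 0 ≤ s) (ht : 0 ≤ t) :
    √(s + t) * Real.sin (Complex.arg ⟨√s, √t⟩) = √t := by
  have h : ‖(⟨√s, √t⟩ : ℂ)‖ = √(s + t) := by
    rw [Complex.norm_def, Complex.normSq_mk, Real.mul_self_sqrt hs, Real.mul_self_sqrt ht]
  rw [← h, Complex.norm_mul_sin_arg]

/-- The square root of the weight of the node at the end of the path held by the qubits `L`. -/
noncomputable def amplitude (L : List D) (b : D → Bool) : ℂ :=
  (√(T.cell (L.map b) .weight) : ℝ)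

/-- As `q ∉ L`, both branches see the same address, hence the same words, and these are cleared on
both. -/
lemma run_splitCircuit (L : List D) (q : D) (b : D → Bool) (hqL : q ∉ L) (hb : b q = false)
    (h0 : ∀ v, 0 ≤ T.cell (L.map b ++ [v]) .weight)
    (hadd : T.cell (L.map b) .weight
      = T.cell (L.map b ++ [false]) .weight + T.cell (L.map b ++ [true]) .weight) :
    (splitCircuit L q).run T (amplitude T L b • dataKet b)
      = amplitude T (L ++ [q]) b • dataKet b
        + amplitude T (L ++ [q]) (Function.update b q true) • dataKet (Function.update b q true) := by
  have hmap : L.map (Function.update b q true) = L.map b :=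
    List.map_congr_left fun s hs => Function.update_of_ne (ne_of_mem_of_not_mem hs hqL) _ _
  have hun := run_uncomputeAngle T L (Function.update b q true)
  rw [hmap] at hun
  rw [splitCircuit, Circuit.run_append, Circuit.run_append, Circuit.run_smul, run_computeAngle,
    Circuit.run_smul, Circuit.run_cons, Circuit.run_nil, apply_rot_data _ _ _ _ q hb,
    Circuit.run_smul, Circuit.run_add, Circuit.run_smul, Circuit.run_smul, run_uncomputeAngle, hun,
    smul_add, smul_smul, smul_smul]
  have h4 : ∀ s t, angleWords s t 4 = Complex.arg ⟨√s, √t⟩ := fun _ _ => rfl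
  simp only [amplitude, h4, List.map_append, hmap, List.map_cons, List.map_nil, hb,
    Function.update_self]
  rw [hadd, ← Complex.ofReal_mul, ← Complex.ofReal_mul, sqrt_mul_cos_arg _ _ (h0 _) (h0 _),
    sqrt_mul_sin_arg _ _ (h0 _) (h0 _)]

/-- The sum of `g` over all ways to overwrite the bits of `b` in the list by zeros (where they are
already zero) or ones. -/
def sumOver {M : Type} [AddCommMonoid M] (g : (D → Bool) → M) : List D → (D → Bool) → M
  | [], b => g b
  | q :: L, b => sumOver g L b + sumOver g L (Function.update b q true)

lemma sumOver_eq_sum [Fintype D] {M : Type} [AddCommMonoid M] (g : (D → Bool) → M) (L : List D)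
    (hL : L.Nodup) (b : D → Bool) (hb : ∀ q ∈ L, b q = false) :
    sumOver g L b = ∑ c with (∀ s, s ∉ L → c s = b s), g c := by
  induction L generalizing b with
  | nil => simp [sumOver, ← funext_iff, Finset.filter_eq']
  | cons q L ih =>
    rw [List.nodup_cons] at hL
    have hq := hb q (by simp)
    rw [sumOver, ih hL.2 b (fun s hs => hb s (by simp [hs])),
      ih hL.2 _ (fun s hs => by
        rw [Function.update_of_ne (ne_of_mem_of_not_mem hs hL.1)]; exact hb s (by simp [hs])),
      -- The two recursive sums are the assignments with `c q` false and those with `c q` true.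
      ← Finset.sum_filter_add_sum_filter_not
        (Finset.univ.filter fun c : D → Bool => ∀ s, s ∉ q :: L → c s = b s) (fun c => c q = false),
      Finset.filter_filter, Finset.filter_filter]
    congr 1
    · refine Finset.sum_congr (Finset.filter_congr fun c _ => ?_) fun _ _ => rfl
      constructor
      · exact fun h => ⟨fun s hs => h s (fun h' => hs (by simp [h'])), by rw [h q hL.1, hq]⟩
      · rintro ⟨h, h'⟩ s hs
        by_cases hsq : s = q
        · rw [hsq, h', hq]
        · exact h s (by simp [hsq, hs])
    · refine Finset.sum_congr (Finset.filter_congr fun c _ => ?_) fun _ _ => rfl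
      constructor
      · intro h
        refine ⟨fun s hs => ?_, by simp [h q hL.1]⟩
        simp only [List.mem_cons, not_or] at hs
        rw [h s hs.2, Function.update_of_ne hs.1]
      · rintro ⟨h, h'⟩ s hs
        by_cases hsq : s = q
        · subst hsq
          simpa using h'
        · rw [Function.update_of_ne hsq]
          exact h s (by simp [hsq, hs])

/-- After one split, linearity lets the induction hypothesis act on each branch; the qubits still to
be split remain zero on both. -/
lemma run_splitAll (L L' : List D) (hL : (L ++ L').Nodup) (b : D → Bool)
    (hb : ∀ q ∈ L', b q = false)
    (h0 : ∀ p : List Bool, p.length ≤ (L ++ L').length → 0 ≤ T.cell p .weight)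
    (hadd : ∀ p : List Bool, p.length < (L ++ L').length → T.cell p .weight
      = T.cell (p ++ [false]) .weight + T.cell (p ++ [true]) .weight) :
    (splitAll L L').run T (amplitude T L b • dataKet b)
      = sumOver (fun c => amplitude T (L ++ L') c • dataKet c) L' b := by
  induction L' generalizing L b with
  | nil => simp [splitAll, sumOver, Circuit.run_nil]
  | cons q L' ih =>
    have hq : q ∉ L ∧ q ∉ L' := by
      rw [List.nodup_append'] at hL
      simp only [List.nodup_cons, List.disjoint_cons_right] at hL
      tauto
    have e : L ++ q :: L' = (L ++ [q]) ++ L' := by simp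
    rw [e] at hL h0 hadd ⊢
    have hl : (L ++ [q] ++ L').length = L.length + L'.length + 1 := by simp; omega
    rw [splitAll, Circuit.run_append, run_splitCircuit T L q b hq.1 (hb q (by simp)),
      Circuit.run_add, ih _ hL b (fun s hs => hb s (by simp [hs])) h0 hadd,
      ih _ hL _ (fun s hs => ?_) h0 hadd, sumOver]
    · rw [Function.update_of_ne (ne_of_mem_of_not_mem hs hq.2)]
      exact hb s (by simp [hs])
    · exact fun v => h0 _ (by simp)
    · exact hadd _ (by simp)

/-- Word 1 is never written and supplies the ordinate 0, so the angle is π for a negative sign and 0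
otherwise. -/
lemma run_signCircuit (L : List D) (b : D → Bool) :
    (signCircuit L).run T (dataKet b)
      = Complex.exp (Complex.I * (Complex.arg ⟨T.cell (L.map b) .sign, 0⟩ : ℂ)) • dataKet b := by
  simp only [signCircuit, Circuit.run_cons, Circuit.run_nil, dataKet, apply_not_aux,
    apply_load_data, apply_arith, Bool.not_false, apply_phase_aux, map_smul, Bool.not_true,
    apply_unload_data, apply_unarith]
  congr 3
  · simp [Arith.eval]
  · ext i
    fin_cases i <;> simp [Function.update]

/-- On a stored leaf, sign times root of the weight recovers the signed number, so the angle is the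
argument of the entry. -/
lemma run_phaseCircuit (L : List D) (b : D → Bool) :
    (phaseCircuit L).run T (dataKet b)
      = Complex.exp (Complex.I * (Complex.arg
          ⟨T.cell (L.map b ++ [false]) .sign * √(T.cell (L.map b ++ [false]) .weight),
            T.cell (L.map b ++ [true]) .sign * √(T.cell (L.map b ++ [true]) .weight)⟩ : ℂ))
        • dataKet b := by
  simp only [phaseCircuit, Circuit.run_cons, Circuit.run_nil, dataKet, apply_not_aux,
    apply_load_child, apply_arith, Bool.not_false, apply_phase_aux, map_smul, Bool.not_true,
    apply_unload_child, apply_unarith]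
  congr 3
  · simp [Arith.eval, Function.update]
  · ext i
    fin_cases i <;> simp [Function.update, Arith.eval]

lemma run_sumOver {r : ℕ} (P : Circuit (D ⊕ Fin 1) r) (g : (D → Bool) → QState (D ⊕ Fin 1) r)
    (L : List D) (b : D → Bool) :
    P.run T (sumOver g L b) = sumOver (fun c => P.run T (g c)) L b := by
  induction L generalizing b with
  | nil => rfl
  | cons q L ih => simp [sumOver, Circuit.run_add, ih]

end Circuits

/-! ### Preparation of the state of a tensor. -/

section Preparation

variable {m : ℕ} {I : Fin m → ℕ}

lemma zeroState_eq_dataKet (D : Type) : zeroState (D ⊕ Fin 1) 9 = dataKet (fun _ => false) := by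
  rw [zeroState, dataKet, dataConfig]
  congr 2
  ext s
  cases s <;> rfl

lemma indexKet_eq_dataKet (i : ∀ k, Fin (I k)) : indexKet 1 9 i = dataKet (indexBit i) := rfl

lemma frobNorm_ne_zero {R : Type} [NormedAddCommGroup R] (A : Tensor R I) (hA : A ≠ 0) :
    frobNorm A ≠ 0 := by
  obtain ⟨i, hi⟩ := Function.ne_iff.1 hA
  have h : 0 < ∑ i, ‖A i‖ ^ 2 :=
    Finset.sum_pos' (fun _ _ => by positivity)
      ⟨i, Finset.mem_univ _, pow_pos (norm_pos_iff.2 hi) 2⟩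
  exact (Real.sqrt_pos.2 h).ne'

/-- Splitting the amplitudes along all data qubits, followed by a circuit that turns the norms of
the entries into the entries, prepares the state of a tensor. -/
lemma run_splitAll_append {R : Type} [NormedAddCommGroup R] (A : Tensor R I) (hA : A ≠ 0)
    (z : R → ℂ) (N : ℕ) (hN : ∑ k, Nat.clog 2 (I k) ≤ N) (f : List Bool → ℝ)
    (hroot : (NormTree.build N f).cell [] .weight = frobNorm A ^ 2)
    (P : Circuit (DataQubit I ⊕ Fin 1) 9)
    (hP : ∀ b : DataQubit I → Bool,
      amplitude (NormTree.build N f) (qubitList I 0) b • P.run (NormTree.build N f) (dataKet b)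
        = (∑ i, if (qubitList I 0).map b = path i then z (A i) else 0) • dataKet b) :
    Circuit.run (NormTree.build N f) (splitAll [] (qubitList I 0) ++ P)
        (zeroState (DataQubit I ⊕ Fin 1) 9)
      = ∑ i, (z (A i) / (frobNorm A : ℂ)) • indexKet 1 9 i := by
  have hne : (frobNorm A : ℂ) ≠ 0 := by exact_mod_cast frobNorm_ne_zero A hA
  have hnil : amplitude (NormTree.build N f) [] (fun _ : DataQubit I => false) = frobNorm A := by
    rw [amplitude, List.map_nil, hroot, Real.sqrt_sq (by unfold frobNorm; positivity)]
  -- Scaled by the norm, the initial state has the amplitude that the invariant demands at the root;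
  -- the factor is divided out at the end because `A ≠ 0`.
  have key : (frobNorm A : ℂ) • Circuit.run (NormTree.build N f) (splitAll [] (qubitList I 0) ++ P)
      (zeroState (DataQubit I ⊕ Fin 1) 9) = ∑ i, z (A i) • indexKet 1 9 i := by
    rw [Circuit.run_append, ← Circuit.run_smul, ← Circuit.run_smul, zeroState_eq_dataKet, ← hnil,
      run_splitAll _ _ _ (by simpa using nodup_qubitList 0) _ (fun _ _ => rfl), run_sumOver,
      sumOver_eq_sum _ _ (nodup_qubitList 0) _ (fun _ _ => rfl)]
    · simp only [List.nil_append, Circuit.run_smul, hP]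
      -- `qubitList I 0` contains every data qubit, so the sum runs over all bit assignments; those
      -- that encode no multi-index contribute zero.
      simp only [mem_qubitList, zero_le, not_true_eq_false, false_imp_iff, implies_true,
        Finset.filter_true, Finset.sum_smul, map_qubitList_eq_path_iff, ite_smul, zero_smul]
      rw [Finset.sum_comm]
      simp [indexKet_eq_dataKet]
    · intro p hp
      exact NormTree.cell_weight_build_nonneg N f p
        (hp.trans (by simpa [length_qubitList] using hN))
    · intro p hp
      exact NormTree.cell_weight_build_add N f p
        (hp.trans_le (by simpa [length_qubitList] using hN))
  rw [← inv_smul_smul₀ hne (Circuit.run _ _ _), key, Finset.smul_sum]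
  refine Finset.sum_congr rfl fun i _ => ?_
  rw [smul_smul, div_eq_inv_mul]

lemma norm_mul_exp_I_mul_arg (z : ℂ) :
    (‖z‖ : ℂ) * Complex.exp (Complex.I * (Complex.arg z : ℂ)) = z := by
  rw [mul_comm Complex.I, Complex.norm_mul_exp_arg_mul_I]

lemma sign_mul_sqrt_sq (t : ℝ) : (SignType.sign t : ℝ) * √(t ^ 2) = t := by
  rw [Real.sqrt_sq_eq_abs, sign_mul_abs]

lemma arg_sign (t : ℝ) : Complex.arg ⟨(SignType.sign t : ℝ), 0⟩ = Complex.arg (t : ℂ) := by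
  have h : (⟨(SignType.sign t : ℝ), 0⟩ : ℂ) = ((SignType.sign t : ℝ) : ℂ) := rfl
  rw [h]
  rcases lt_trichotomy t 0 with ht | rfl | ht
  · simp [sign_neg ht, Complex.arg_ofReal_of_neg ht]
  · simp
  · simp [sign_pos ht, Complex.arg_ofReal_of_nonneg ht.le]

/-- The state preparation circuit for real tensors. -/
def realCircuit (I : Fin m → ℕ) : Circuit (DataQubit I ⊕ Fin 1) 9 :=
  splitAll [] (qubitList I 0) ++ signCircuit (qubitList I 0)

/-- The state preparation circuit for complex tensors. -/
def complexCircuit (I : Fin m → ℕ) : Circuit (DataQubit I ⊕ Fin 1) 9 :=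
  splitAll [] (qubitList I 0) ++ phaseCircuit (qubitList I 0)

lemma run_realCircuit (A : Tensor ℝ I) (hA : A ≠ 0) :
    (realCircuit I).run (realTree A) (zeroState (DataQubit I ⊕ Fin 1) 9)
      = ∑ i, ((A i : ℂ) / (frobNorm A : ℂ)) • indexKet 1 9 i := by
  refine run_splitAll_append A hA _ _ le_rfl _ ?_ _ fun b => ?_
  · exact (cell_realTree A [] (by simp)).trans (by simp [frobNorm_sq])
  · have hl : ((qubitList I 0).map b).length = ∑ k, Nat.clog 2 (I k) := by simp [length_qubitList]
    rw [run_signCircuit, amplitude, NormTree.cell_weight_build_leaf _ _ _ hl,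
      NormTree.cell_sign_build_leaf _ _ _ hl, smul_smul, Real.sqrt_sq_eq_abs, arg_sign,
      ← Real.norm_eq_abs, ← Complex.norm_real, norm_mul_exp_I_mul_arg]
    simp [apply_ite Complex.ofReal]

lemma run_complexCircuit (A : Tensor ℂ I) (hA : A ≠ 0) :
    (complexCircuit I).run (complexTree A) (zeroState (DataQubit I ⊕ Fin 1) 9)
      = ∑ i, (A i / (frobNorm A : ℂ)) • indexKet 1 9 i := by
  refine run_splitAll_append A hA id ((∑ k, Nat.clog 2 (I k)) + 1) (Nat.le_succ _)
    (complexLeaf A) ?_ _ fun b => ?_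
  · exact (cell_complexTree A [] (by simp)).trans (by simp [frobNorm_sq])
  · have hl : ((qubitList I 0).map b).length = ∑ k, Nat.clog 2 (I k) := by simp [length_qubitList]
    -- The node of an entry is interior here: its weight is the sum of the two leaves, re² + im².
    rw [run_phaseCircuit, amplitude, NormTree.cell_weight_build_add _ _ _ (by omega)]
    have hl' : ∀ v, ((qubitList I 0).map b ++ [v]).length = (∑ k, Nat.clog 2 (I k)) + 1 := by
      simp [length_qubitList]
    simp only [fun v => NormTree.cell_weight_build_leaf _ (complexLeaf A) _ (hl' v),
      fun v => NormTree.cell_sign_build_leaf _ (complexLeaf A) _ (hl' v), sign_mul_sqrt_sq,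
      complexLeaf_false, complexLeaf_true, id]
    generalize (∑ i, if (qubitList I 0).map b = path i then A i else 0) = z
    rw [smul_smul, pow_two, pow_two, ← Complex.normSq_apply, ← Complex.norm_def, Complex.eta,
      norm_mul_exp_I_mul_arg]

/-! ### The polylogarithmic time bound. -/

/-- For `x ≥ 2` the ceiling at most doubles the floor of log₂, and 2 / log 2 < 3. At `x = 1` both
sides vanish, so modes of size one cost nothing; this makes the bound uniform in the order `m`. -/
lemma clog_le_log (x : ℕ) (hx : 0 < x) : (Nat.clog 2 x : ℝ) ≤ 3 * Real.log x := by
  rcases Nat.lt_or_ge 1 x with h | h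
  · have h1 : Nat.clog 2 x ≤ 2 * Nat.log 2 x := by
      have h2 : Nat.clog 2 x ≤ Nat.log 2 x + 1 :=
        Nat.clog_le_of_le_pow (Nat.lt_pow_succ_log_self one_lt_two x).le
      have h3 : 0 < Nat.log 2 x := Nat.log_pos one_lt_two h
      omega
    have h4 : (Nat.log 2 x : ℝ) * Real.log 2 ≤ Real.log x := by
      rw [← Real.log_pow]
      apply Real.log_le_log (by positivity)
      exact_mod_cast Nat.pow_log_le_self 2 hx.ne'
    have h5 : (Nat.clog 2 x : ℝ) ≤ 2 * Nat.log 2 x := by exact_mod_cast h1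
    have h6 := Real.log_two_gt_d9
    have h7 : (0 : ℝ) ≤ Nat.log 2 x := Nat.cast_nonneg _
    nlinarith
  · obtain rfl : x = 1 := by omega
    simp

lemma sum_clog_le_log (hI : ∀ k, 0 < I k) :
    ((∑ k, Nat.clog 2 (I k) : ℕ) : ℝ) ≤ 3 * Real.log (∏ k, (I k : ℝ)) := by
  rw [Real.log_prod fun k _ => by exact_mod_cast (hI k).ne', Finset.mul_sum, Nat.cast_sum]
  exact Finset.sum_le_sum fun k _ => clog_le_log _ (hI k)

lemma time_le_polylog (hI : ∀ k, 0 < I k) (P : Circuit (DataQubit I ⊕ Fin 1) 9)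
    (hP : P.time ≤ 8 * (qubitList I 0).length + 29) :
    (Circuit.time (splitAll [] (qubitList I 0) ++ P) : ℝ)
      ≤ (261 : ℕ) * (1 + Real.log (∏ k, (I k : ℝ))) ^ 2 := by
  have h1 := time_splitAll [] (qubitList I 0)
  rw [length_qubitList] at h1 hP
  have h3 := sum_clog_le_log hI
  rw [Circuit.time_append]
  generalize ∑ k, Nat.clog 2 (I k) = n at h1 hP h3
  generalize Real.log (∏ k, (I k : ℝ)) = t at h3
  -- The total is at most n(4n + 19) + 8n + 29; with n + 1 ≤ 3(1 + t) the constant becomes 29 · 9 =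
  -- 261.
  have h4 : (splitAll [] (qubitList I 0)).time + P.time ≤ 29 * (n + 1) ^ 2 := by
    simp only [List.length_nil] at h1
    nlinarith
  have h5 : ((n : ℝ) + 1) ^ 2 ≤ (3 * (1 + t)) ^ 2 :=
    pow_le_pow_left₀ (by positivity) (by linarith) 2
  calc (((splitAll [] (qubitList I 0)).time + P.time : ℕ) : ℝ) ≤ 29 * ((n : ℝ) + 1) ^ 2 := by
        exact_mod_cast h4
    _ ≤ (261 : ℕ) * (1 + t) ^ 2 := by push_cast; nlinarith

end Preparation

end QuantumTensor

theorem theorem1 :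
    ∃ C d a r : ℕ, ∀ (m : ℕ) (I : Fin m → ℕ), (∀ k, 0 < I k) →
      -- real tensors
      ((∀ A : Tensor ℝ I,
          StoresNorms A (realTree A) ∧
          ∀ i, (realTree A).subtree (path i)
            = some (NormTree.leaf ((A i) ^ 2) (SignType.sign (A i)))) ∧
        ∃ P : Circuit (DataQubit I ⊕ Fin a) r,
          (P.time : ℝ) ≤ C * (1 + Real.log (∏ k, (I k : ℝ))) ^ d ∧
          ∀ A : Tensor ℝ I, A ≠ 0 →
            P.run (realTree A) (zeroState (DataQubit I ⊕ Fin a) r)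
              = ∑ i, ((A i : ℂ) / (frobNorm A : ℂ)) • indexKet a r i) ∧
      -- complex tensors
      ((∀ A : Tensor ℂ I,
          StoresNorms A (complexTree A) ∧
          ∀ i,
            (complexTree A).subtree (path i ++ [false])
              = some (NormTree.leaf ((A i).re ^ 2) (SignType.sign (A i).re)) ∧
            (complexTree A).subtree (path i ++ [true])
              = some (NormTree.leaf ((A i).im ^ 2) (SignType.sign (A i).im))) ∧
        ∃ P : Circuit (DataQubit I ⊕ Fin a) r,
          (P.time : ℝ) ≤ C * (1 + Real.log (∏ k, (I k : ℝ))) ^ d ∧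
          ∀ A : Tensor ℂ I, A ≠ 0 →
            P.run (complexTree A) (zeroState (DataQubit I ⊕ Fin a) r)
              = ∑ i, (A i / (frobNorm A : ℂ)) • indexKet a r i) := by
  -- The nine words are those of `phaseCircuit`, the most demanding part; its time also sets the
  -- allowance 8n + 29, which the sign circuit meets with room to spare.
  refine ⟨261, 2, 1, 9, fun m I hI => ⟨⟨fun A => ⟨storesNorms_realTree A, subtree_realTree A⟩,
    realCircuit I, time_le_polylog hI _ ?_, run_realCircuit⟩,
    fun A => ⟨storesNorms_complexTree A, fun i =>
      ⟨subtree_complexTree_false A i, subtree_complexTree_true A i⟩⟩,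
    complexCircuit I, time_le_polylog hI _ (time_phaseCircuit _).le, run_complexCircuit⟩⟩
  rw [time_signCircuit]
  omega
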